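/- Conventions. A Borel equivalence relation $E$ on a standard Borel space $X$ is *countable* if every $E$-class is countable, and *smooth* if there are a standard Borel space $Z$ and a Borel map $f:X\to Z$ with $x\mathrel{E}y\iff f(x)=f(y)$. For equivalence relations $E\subseteq F$ on $X$ and $E'\subseteq F'$ on $Y$, write $(E,F)\sqsubseteq_B(E',F')$ if there is an injective Borel map $f:X\to Y$ such that, for all $x,y\in X$, $x\mathrel{E}y\iff f(x)\mathrel{E'}f(y)$ and $x\mathrel{F}y\iff f(x)\mathrel{F'}f(y)$; and write $(E,F)\approx_B(E',F')$ if $(E,F)\sqsubseteq_B(E',F')$ and $(E',F')\sqsubseteq_B(E,F)$. For countable $E\subseteq F$ and an $F$-class $C$, the *local coarse shape* of $C$ is the function $\mathrm{lcs}^{(E,F)}(C):\{1,2,\dots,\omega\}\to\{0,1,\dots,\omega\}$ sending $m$ to the number of $E$-classes contained in $C$ that have at least $m$ elements. Let $S_c$ be the set of all functions that arise in this way, that is, of all functions $m\mapsto\#\{\text{classes of } R \text{ with at least } m \text{ elements}\}$, where $R$ is an equivalence relation on a nonempty countable set; order $S_c$ pointwise. For every upper set $W\subseteq S_c$ (if $\alpha\in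 W$, $\beta\in S_c$ and $\alpha\le\beta$, then $\beta\in W$), let $\mathrm{gcs}(E,F)(W)$ be the cardinal number of the set of $F$-classes $C$ with $\mathrm{lcs}^{(E,F)}(C)\in W$. Write $\mathrm{gcs}(E,F)\le\mathrm{gcs}(E',F')$ if $\mathrm{gcs}(E,F)(W)\le\mathrm{gcs}(E',F')(W)$ for every upper set $W\subseteq S_c$. Theorem. Let $E\subseteq F$ and $E'\subseteq F'$ be smooth countable Borel equivalence relations on the standard Borel spaces $X$ and $Y$, respectively. Then $$(E,F)\sqsubseteq_B(E',F')\iff \mathrm{gcs}(E,F)\le\mathrm{gcs}(E',F').$$ In particular, $(E,F)\approx_B(E',F')$ if and only if $\mathrm{gcs}(E,F)=\mathrm{gcs}(E',F')$. -/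

import Mathlib

universe u v

/-- The index set `{1, 2, …, ω}` of possible sizes of nonempty countable sets. -/
abbrev ShapeIndex : Type := {m : ℕ∞ // 1 ≤ m}

/-- For an equivalence relation `r` on a countable set `A`: the sequence whose `m`-th term,
`1 ≤ m ≤ ω`, is the number of `r`-classes having at least `m` elements. On a countable set all
numbers involved lie in `{0, 1, …, ω} = ℕ∞`. -/
noncomputable def countableCoarseShape {A : Type*} (r : Setoid A) : ShapeIndex → ℕ∞ :=
  fun m => Set.encard {c : Set A | c ∈ r.classes ∧ m.1 ≤ c.encard}

/-- The restriction `E ↾ C` of an equivalence relation on `X` to a subset `C`. -/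
def restrictRel {X : Type*} (E : Setoid X) (C : Set X) : Setoid C :=
  E.comap (Subtype.val : C → X)

/-- The local coarse shape of a (countable) class `C` of the larger relation, relative to the
smaller relation `E`. -/
noncomputable def localCoarseShape {X : Type*} (E : Setoid X) (C : Set X) : ShapeIndex → ℕ∞ :=
  countableCoarseShape (restrictRel E C)

/-- The set of all possible local coarse shapes, i.e. the coarse shapes of equivalence relations on
nonempty countable sets. As a type it carries the pointwise order. -/
def LocalCoarseShapes : Set (ShapeIndex → ℕ∞) :=
  {α | ∃ (A : Type) (_ : Countable A) (_ : Nonempty A) (r : Setoid A), countableCoarseShape r = α}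

/-- All classes are countable. -/
def HasCountableClasses {X : Type*} (E : Setoid X) : Prop :=
  ∀ C ∈ E.classes, C.Countable

/-- `E` is smooth: it is Borel reducible to equality on some standard Borel space. -/
def IsSmoothRel {X : Type*} [MeasurableSpace X] (E : Setoid X) : Prop :=
  ∃ (Z : Type) (_ : MeasurableSpace Z) (_ : StandardBorelSpace Z) (f : X → Z),
    Measurable f ∧ ∀ x y, E x y ↔ f x = f y

/-- The global coarse shape of the pair `(E, F)`: to an upper set `W` of local coarse shapes it
assigns the cardinal number of `F`-classes whose local coarse shape belongs to `W`. -/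
noncomputable def globalCoarseShape {X : Type*} (E F : Setoid X)
    (W : UpperSet LocalCoarseShapes) : Cardinal :=
  Cardinal.mk {C : Set X // C ∈ F.classes ∧ ∃ α ∈ W, α.1 = localCoarseShape E C}

/-- `(E, F)` simultaneously Borel-embeds into `(E', F')`. -/
def SimBorelEmbeds {X Y : Type*} [MeasurableSpace X] [MeasurableSpace Y]
    (E F : Setoid X) (E' F' : Setoid Y) : Prop :=
  ∃ f : X → Y, Measurable f ∧ Function.Injective f ∧
    (∀ x y, E x y ↔ E' (f x) (f y)) ∧ (∀ x y, F x y ↔ F' (f x) (f y))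

/-- Coarse shapes do not depend on the names of the points. -/
theorem countableCoarseShape_comap_equiv {A B : Type*} (e : B ≃ A) (r : Setoid A) :
    countableCoarseShape (r.comap e) = countableCoarseShape r := by
  funext m
  unfold countableCoarseShape
  have hinj : Function.Injective (fun c : Set B => e '' c) := Set.image_injective.2 e.injective
  rw [← hinj.encard_image]
  congr 1
  ext c
  constructor
  · rintro ⟨d, ⟨⟨y, rfl⟩, hm⟩, rfl⟩
    refine ⟨⟨e y, ?_⟩, ?_⟩
    · ext a
      constructor
      · rintro ⟨b, hb, rfl⟩
        exact hb
      · intro ha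
        refine ⟨e.symm a, ?_, by simp⟩
        change r (e (e.symm a)) (e y)
        simpa using ha
    · simpa only [e.injective.encard_image] using hm
  · rintro ⟨⟨y, rfl⟩, hm⟩
    refine ⟨e ⁻¹' {x | r x y}, ⟨⟨e.symm y, ?_⟩, ?_⟩, ?_⟩
    · ext b
      change r (e b) y ↔ r (e b) (e (e.symm y))
      simp
    · rw [← e.injective.encard_image, Set.image_preimage_eq _ e.surjective]
      exact hm
    · exact Set.image_preimage_eq _ e.surjective

/-- The local coarse shape of a class of a relation with countable classes is a member of
`LocalCoarseShapes`; so no class is left out in `globalCoarseShape`. -/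
theorem localCoarseShape_mem {X : Type*} (E F : Setoid X) (hF : HasCountableClasses F)
    (C : Set X) (hC : C ∈ F.classes) : localCoarseShape E C ∈ LocalCoarseShapes := by
  have hc : Countable C := (hF C hC).to_subtype
  have hn : Nonempty C := by
    obtain ⟨y, rfl⟩ := hC
    exact ⟨⟨y, F.refl y⟩⟩
  let e : Shrink.{0} C ≃ C := (equivShrink.{0} C).symm
  exact ⟨Shrink.{0} C, e.injective.countable, ⟨e.symm hn.some⟩, (restrictRel E C).comap e,
    countableCoarseShape_comap_equiv e _⟩

/-! Forwards, an embedding carries distinct `F`-classes into distinct `F'`-classes and can only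
raise local coarse shapes, so an upper set of shapes catches at least as many classes on the right.

Backwards, `exists_borelCoordinates` turns smoothness into coordinates, by Lusin–Novikov: an
`F`-class becomes a point `z` of a standard Borel space, an `E`-class inside it a row number, and an
element its rank in the row. It then suffices to choose in a Borel way an injection `Φ` of base
points that does not lower shapes, and over each `z` an injection of nonempty rows into rows at
least as long; ranks are kept.

For `Φ`, the point is that shapes form a countable well-quasi-order (Higman's lemma).
Well-quasi-ordering makes Hall's condition on upper sets sufficient for countable families
(`exists_injective_le_of_encard_le`): only finitely many targets carry a label with finitely many
targets above it, and all other demands can be met greedily. Countability handles the uncountable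
part (`exists_measurable_injective_le`): a label with uncountably many targets above it lies below a
single label with an uncountable fibre, which has room for a Borel copy of the whole index space.

For the rows, the same marriage theorem over `ℕ∞` gives a matching over each `z`; always taking the
least index that leaves the remaining rows matchable makes the choice Borel
(`exists_measurable_matching`). -/

/-! ### The Lusin–Novikov theorem, by a Cantor scheme inside a fibre. -/

section LusinNovikov
open Set MeasureTheory

variable {X Z : Type*} [MeasurableSpace X]

/-- `A` is covered by countably many measurable sets on each of which `f` is injective. -/
def SigmaInjOn (f : X → Z) (A : Set X) : Prop :=
  ∃ C : ℕ → Set X, (∀ n, MeasurableSet (C n)) ∧ (∀ n, InjOn f (C n)) ∧ A ⊆ ⋃ n, C n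

theorem SigmaInjOn.mono {f : X → Z} {A B : Set X} (h : SigmaInjOn f B) (hAB : A ⊆ B) :
    SigmaInjOn f A := by
  obtain ⟨C, h1, h2, h3⟩ := h
  exact ⟨C, h1, h2, hAB.trans h3⟩

theorem sigmaInjOn_empty (f : X → Z) : SigmaInjOn f ∅ :=
  ⟨fun _ => ∅, fun _ => .empty, fun _ => injOn_empty f, empty_subset _⟩

theorem sigmaInjOn_of_injOn {f : X → Z} {A : Set X} (hA : MeasurableSet A) (h : InjOn f A) :
    SigmaInjOn f A :=
  ⟨fun _ => A, fun _ => hA, fun _ => h, (iUnion_const A).symm.subset⟩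

theorem sigmaInjOn_iUnion {ι : Type*} [Countable ι] {f : X → Z} {A : ι → Set X}
    (h : ∀ i, SigmaInjOn f (A i)) : SigmaInjOn f (⋃ i, A i) := by
  rcases isEmpty_or_nonempty ι with hι | hι
  · simpa using sigmaInjOn_empty f
  choose C h1 h2 h3 using h
  obtain ⟨e, he⟩ := exists_surjective_nat (ι × ℕ)
  refine ⟨fun n => C (e n).1 (e n).2, fun n => h1 _ _, fun n => h2 _ _, ?_⟩
  refine iUnion_subset fun i x hx => ?_
  obtain ⟨k, hk⟩ := mem_iUnion.1 (h3 i hx)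
  obtain ⟨n, hn⟩ := he (i, k)
  exact mem_iUnion.2 ⟨n, by simpa [hn] using hk⟩

theorem SigmaInjOn.union {f : X → Z} {A B : Set X} (hA : SigmaInjOn f A) (hB : SigmaInjOn f B) :
    SigmaInjOn f (A ∪ B) := by
  rw [union_eq_iUnion]
  exact sigmaInjOn_iUnion fun b => by cases b <;> simpa

/-- The target is covered by measurable sets `T i` such that each `A i` is `SigmaInjOn` over
`T i`. -/
def SigmaInjFamily {ι : Type*} [MeasurableSpace Z] (f : X → Z) (A : ι → Set X) : Prop :=
  ∃ T : ι → Set Z, (∀ i, MeasurableSet (T i)) ∧ (∀ z, ∃ i, z ∈ T i) ∧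
    ∀ i, SigmaInjOn f (A i ∩ f ⁻¹' T i)

/-- Over the complement of `O` the set `A i` is empty, over `O` the set `A j` is. Hence in a family
that is not `SigmaInjFamily` no two images can be separated by a measurable set; with `i = j` and `O
= univ`, no member is empty. -/
theorem sigmaInjFamily_of_disjoint {ι : Type*} [MeasurableSpace Z] {f : X → Z}
    {A : ι → Set X} (i j : ι) (O : Set Z)
    (hO : MeasurableSet O) (hi : A i ⊆ f ⁻¹' O) (hj : Disjoint (A j) (f ⁻¹' O)) :
    SigmaInjFamily f A := by
  classical
  refine ⟨fun k => {z | (k = i ∧ z ∉ O) ∨ (k = j ∧ z ∈ O)}, fun k => ?_, fun z => ?_, fun k => ?_⟩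
  · exact ((MeasurableSet.const _).inter hO.compl).union ((MeasurableSet.const _).inter hO)
  · by_cases hz : z ∈ O
    · exact ⟨j, .inr ⟨rfl, hz⟩⟩
    · exact ⟨i, .inl ⟨rfl, hz⟩⟩
  · refine (sigmaInjOn_empty f).mono ?_
    rintro x ⟨hx, ⟨rfl, h⟩ | ⟨rfl, h⟩⟩
    · exact h (hi hx)
    · exact disjoint_left.1 hj hx h

/-- A family of sets that is not `SigmaInjFamily` can be split into two halves along countably many
separating pairs of sets. -/
theorem exists_split_not_sigmaInjFamily {ι D : Type*} [MeasurableSpace Z] [Finite ι] [Countable D]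
    (U : D → Bool → Set X) (hU : ∀ d b, MeasurableSet (U d b))
    (hsep : ∀ x y, x ≠ y → ∃ d, x ∈ U d true ∧ y ∈ U d false) {f : X → Z} (hf : Measurable f)
    {A : ι → Set X} (hA : ∀ i, MeasurableSet (A i)) (hbig : ¬ SigmaInjFamily f A) :
    ∃ c : ι → D, ¬ SigmaInjFamily f (fun k : ι × Bool => A k.1 ∩ U (c k.1) k.2) := by
  by_contra! hcon
  apply hbig
  choose T hT hcov hsm using hcon
  -- Diagonalization: if `z` lay in none of these sets, the failing `d` for each `i` would assemble
  -- into one `c` whose sets `T c` miss `z`.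
  refine ⟨fun i => ⋂ d : D, ⋃ c : {c : ι → D // c i = d}, ⋃ b, T c.1 (i, b), fun i => ?_,
    fun z => ?_, fun i => ?_⟩
  · exact .iInter fun d => .iUnion fun c => .iUnion fun b => hT _ _
  · by_contra! hz
    simp only [mem_iInter, mem_iUnion, not_forall, not_exists] at hz
    choose c hc using hz
    obtain ⟨⟨i, b⟩, hk⟩ := hcov c z
    exact hc i ⟨c, rfl⟩ b hk
  · set S : Set Z := ⋂ d : D, ⋃ c : {c : ι → D // c i = d}, ⋃ b, T c.1 (i, b) with hS
    have hSm : MeasurableSet S := .iInter fun d => .iUnion fun c => .iUnion fun b => hT _ _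
    let N : Set X := ⋃ c : ι → D, ⋃ b, A i ∩ U (c i) b ∩ f ⁻¹' T c (i, b)
    have hN : SigmaInjOn f N :=
      sigmaInjOn_iUnion fun c => sigmaInjOn_iUnion fun b => hsm c (i, b)
    have hNm : MeasurableSet N :=
      .iUnion fun c => .iUnion fun b => ((hA i).inter (hU _ _)).inter (hf (hT _ _))
    -- Off `N` the map is injective: for two points of one fibre separated by `d`, membership of
    -- their common value in `S` puts one of them in `N`.
    have hR : SigmaInjOn f ((A i ∩ f ⁻¹' S) \ N) := by
      refine sigmaInjOn_of_injOn (((hA i).inter (hf hSm)).diff hNm) ?_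
      rintro x ⟨⟨hxA, hxS⟩, hxN⟩ y ⟨⟨hyA, -⟩, hyN⟩ hxy
      by_contra hne
      obtain ⟨d, hxd, hyd⟩ := hsep x y hne
      have := mem_iInter.1 hxS d
      simp only [mem_iUnion] at this
      obtain ⟨⟨c, rfl⟩, b, hb⟩ := this
      cases b
      · exact hyN (mem_iUnion.2 ⟨c, mem_iUnion.2 ⟨false, ⟨hyA, hyd⟩, by simpa [← hxy] using hb⟩⟩)
      · exact hxN (mem_iUnion.2 ⟨c, mem_iUnion.2 ⟨true, ⟨hxA, hxd⟩, hb⟩⟩)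
    exact (hN.union hR).mono fun x hx => by
      by_cases h : x ∈ N
      · exact .inl h
      · exact .inr ⟨hx, h⟩

theorem exists_countable_separating_closed (X : Type*) [MetricSpace X]
    [TopologicalSpace.SeparableSpace X] (ε : ℝ) (hε : 0 < ε) :
    ∃ U : (ℕ × ℕ × ℕ) → Bool → Set X, (∀ d b, IsClosed (U d b)) ∧
      (∀ d, Disjoint (U d true) (U d false)) ∧
      (∀ d b, ∀ x ∈ U d b, ∀ y ∈ U d b, dist x y ≤ ε) ∧
      ∀ x y, x ≠ y → ∃ d, x ∈ U d true ∧ y ∈ U d false := by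
  classical
  rcases isEmpty_or_nonempty X with hX | hX
  · exact ⟨fun _ _ => ∅, by simp, by simp, by simp, fun x => (hX.false x).elim⟩
  let u := TopologicalSpace.denseSeq X
  let V : (ℕ × ℕ × ℕ) → Bool → Set X := fun d b =>
    Metric.closedBall (u (bif b then d.1 else d.2.1)) (1 / (d.2.2 + 1))
  let ok : ℕ × ℕ × ℕ → Prop := fun d =>
    Disjoint (V d true) (V d false) ∧ (1 / (d.2.2 + 1) : ℝ) ≤ ε / 2
  refine ⟨fun d b => if ok d then V d b else ∅, fun d b => ?_, fun d => ?_, fun d b x hx y hy => ?_,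
    fun x y hxy => ?_⟩
  · dsimp only
    split_ifs
    · exact Metric.isClosed_closedBall
    · exact isClosed_empty
  · dsimp only
    split_ifs with h
    · exact h.1
    · simp
  · by_cases h : ok d
    · simp only [h, if_true, V, Metric.mem_closedBall] at hx hy
      have := dist_triangle_right x y (u (bif b then d.1 else d.2.1))
      linarith [h.2]
    · simp [h] at hx
  · have hd : 0 < dist x y := dist_pos.2 hxy
    obtain ⟨k, hk⟩ := exists_nat_one_div_lt (lt_min (half_pos hε) (div_pos hd (by norm_num : (0:ℝ) < 4)))
    have hk0 : (0 : ℝ) < 1 / (k + 1) := by positivity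
    obtain ⟨a, ha⟩ := (TopologicalSpace.denseRange_denseSeq X).exists_dist_lt x hk0
    obtain ⟨b, hb⟩ := (TopologicalSpace.denseRange_denseSeq X).exists_dist_lt y hk0
    have hok : ok (a, b, k) := by
      refine ⟨?_, (hk.trans_le (min_le_left _ _)).le⟩
      refine disjoint_left.2 fun w hw hw' => ?_
      simp only [V, Metric.mem_closedBall, cond_true, cond_false] at hw hw'
      have h4 := hk.trans_le (min_le_right _ _)
      have h1 := dist_triangle4 x (u a) (u b) y
      have h2 := dist_triangle_left (u a) (u b) w
      rw [dist_comm] at hb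
      linarith
    refine ⟨(a, b, k), ?_⟩
    simp only [hok, if_true, V, Metric.mem_closedBall, cond_true, cond_false]
    exact ⟨ha.le, hb.le⟩

/-- If `f` is continuous and its domain is not a countable union of measurable sets on which `f`
is injective, then some fibre of `f` contains a copy of the Cantor space. -/
theorem exists_cantor_fibre_of_not_sigmaInjOn {X Z : Type*} [MetricSpace X] [CompleteSpace X]
    [TopologicalSpace.SeparableSpace X] [MeasurableSpace X] [BorelSpace X]
    [TopologicalSpace Z] [T2Space Z] [MeasurableSpace Z] [BorelSpace Z]
    {f : X → Z} (hf : Continuous f) (hbig : ¬ SigmaInjOn f univ) :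
    ∃ φ : (ℕ → Bool) → X, φ.Injective ∧ ∀ σ τ, f (φ σ) = f (φ τ) := by
  -- Largeness is required of each whole level jointly, not of each set: this is what forces all
  -- branches into the same fibre.
  let Good : ℕ → (List Bool → Set X) → Prop := fun n A => (∀ l, IsClosed (A l)) ∧
    ¬ SigmaInjFamily f (fun l : {l : List Bool // l.length = n} => A l.1)
  have step : ∀ n (A : List Bool → Set X), Good n A → ∃ A' : List Bool → Set X, Good (n + 1) A' ∧
      ∀ l, l.length = n → (∀ b, A' (b :: l) ⊆ A l) ∧
        Disjoint (A' (true :: l)) (A' (false :: l)) ∧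
        ∀ b, ∀ x ∈ A' (b :: l), ∀ y ∈ A' (b :: l), dist x y ≤ 1 / ((n : ℝ) + 1) := by
    rintro n A ⟨hcl, hA⟩
    obtain ⟨U, hUc, hUd, hUs, hUsep⟩ := exists_countable_separating_closed X (1 / ((n : ℝ) + 1))
      (by positivity)
    have : Finite {l : List Bool // l.length = n} := List.finite_length_eq Bool n
    obtain ⟨c, hc⟩ := exists_split_not_sigmaInjFamily U (fun d b => (hUc d b).measurableSet) hUsep
      hf.measurable (fun l : {l : List Bool // l.length = n} => (hcl l.1).measurableSet) hA
    classical
    let A' : List Bool → Set X := fun l => match l with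
      | [] => ∅
      | b :: l => if h : l.length = n then A l ∩ U (c ⟨l, h⟩) b else ∅
    refine ⟨A', ⟨fun l => ?_, fun hsm => hc ?_⟩, fun l hl => ⟨fun b => ?_, ?_, fun b => ?_⟩⟩
    · rcases l with _ | ⟨b, l⟩
      · exact isClosed_empty
      · dsimp only [A']
        split_ifs with h
        · exact (hcl l).inter (hUc _ _)
        · exact isClosed_empty
    · obtain ⟨T, hT, hcov, hs⟩ := hsm
      refine ⟨fun k => T ⟨k.2 :: k.1.1, by simp [k.1.2]⟩, fun k => hT _, fun z => ?_, fun k => ?_⟩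
      · obtain ⟨⟨l, hl⟩, hz⟩ := hcov z
        rcases l with _ | ⟨b, l⟩
        · simp at hl
        · exact ⟨(⟨l, by simpa using hl⟩, b), hz⟩
      · have := hs ⟨k.2 :: k.1.1, by simp [k.1.2]⟩
        simpa [A', k.1.2] using this
    · simp only [A', hl, dif_pos]
      exact inter_subset_left
    · simp only [A', hl, dif_pos]
      exact (hUd _).mono inter_subset_right inter_subset_right
    · simp only [A', hl, dif_pos]
      intro x hx y hy
      exact hUs _ _ x hx.2 y hy.2
  choose! next hnext hprop using step
  let seq : ℕ → List Bool → Set X := fun n => Nat.rec (fun _ => univ) (fun n A => next n A) n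
  have hgood : ∀ n, Good n (seq n) := by
    intro n
    induction n with
    | zero =>
      refine ⟨fun l => isClosed_univ, fun hsm => hbig ?_⟩
      obtain ⟨T, hT, hcov, hs⟩ := hsm
      refine (hs ⟨[], rfl⟩).mono fun x _ => ⟨trivial, ?_⟩
      obtain ⟨⟨l, hl⟩, hz⟩ := hcov (f x)
      rw [List.length_eq_zero_iff] at hl
      subst hl
      exact hz
    | succ n ih => exact hnext n _ ih
  have hstep := fun n (l : List Bool) (hl : l.length = n) => hprop n (seq n) (hgood n) l hl
  let A : List Bool → Set X := fun l => seq l.length l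
  have hAcons : ∀ l b, A (b :: l) = next l.length (seq l.length) (b :: l) := fun l b => rfl
  have hne : ∀ l, (A l).Nonempty := by
    intro l
    by_contra hl
    rw [not_nonempty_iff_eq_empty] at hl
    refine (hgood l.length).2 (sigmaInjFamily_of_disjoint ⟨l, rfl⟩ ⟨l, rfl⟩ univ .univ ?_ ?_)
    · exact fun _ _ => trivial
    · change Disjoint (A l) _
      exact hl ▸ empty_disjoint _
  have hanti : CantorScheme.Antitone A := fun l b => (hstep _ l rfl).1 b
  have hdisj : CantorScheme.Disjoint A := by
    intro l a b hab
    have := (hstep _ l rfl).2.1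
    cases a <;> cases b <;> first | exact absurd rfl hab | exact this | exact this.symm
  have hclosed : ∀ l, IsClosed (A l) := fun l => (hgood l.length).1 l
  have hdiam' : ∀ (σ : ℕ → Bool) n, ∀ x ∈ A (PiNat.res σ (n + 1)), ∀ y ∈ A (PiNat.res σ (n + 1)),
      dist x y ≤ 1 / ((n : ℝ) + 1) := by
    intro σ n
    have := (hstep _ (PiNat.res σ n) rfl).2.2 (σ n)
    rw [PiNat.res_length] at this
    rw [PiNat.res_succ, hAcons, PiNat.res_length]
    exact this
  have hdiam : CantorScheme.VanishingDiam A := by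
    intro σ
    rw [ENNReal.tendsto_atTop_zero]
    intro ε hε
    obtain ⟨r, hr0, hrε⟩ := ENNReal.lt_iff_exists_real_btwn.1 hε
    have hr : 0 < r := ENNReal.ofReal_pos.1 hrε.1
    obtain ⟨n, hn⟩ := exists_nat_one_div_lt hr
    refine ⟨n + 1, fun m hm => ?_⟩
    obtain ⟨m, rfl⟩ : ∃ k, m = k + 1 := ⟨m - 1, by omega⟩
    refine (Metric.ediam_le fun x hx y hy => ?_).trans hrε.2.le
    rw [edist_dist]
    refine ENNReal.ofReal_le_ofReal ((hdiam' σ m x hx y hy).trans (le_trans ?_ hn.le))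
    apply one_div_le_one_div_of_le (by positivity)
    have : (n : ℝ) ≤ m := by exact_mod_cast (by omega : n ≤ m)
    linarith
  have hdom := (hanti.closureAntitone hclosed).map_of_vanishingDiam hdiam hne
  let φ : (ℕ → Bool) → X := fun σ => (CantorScheme.inducedMap A).2 ⟨σ, by rw [hdom]; trivial⟩
  have hφ : ∀ σ n, φ σ ∈ A (PiNat.res σ n) := fun σ n => CantorScheme.map_mem _ n
  refine ⟨φ, fun σ τ h => ?_, fun σ τ => ?_⟩
  · simpa using hdisj.map_injective h
  · by_contra hne'
    obtain ⟨O, O', hO, hO', hσ, hτ, hOO⟩ := t2_separation hne'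
    have key : ∀ (σ : ℕ → Bool) (O : Set Z), IsOpen O → f (φ σ) ∈ O →
        ∃ n, ∀ m ≥ n, A (PiNat.res σ m) ⊆ f ⁻¹' O := by
      intro σ O hO hmem
      obtain ⟨ε, hε, hball⟩ := Metric.isOpen_iff.1 (hO.preimage hf) _ hmem
      obtain ⟨n, hn⟩ := exists_nat_one_div_lt hε
      refine ⟨n + 1, fun m hm => ?_⟩
      have hsub : A (PiNat.res σ m) ⊆ A (PiNat.res σ (n + 1)) := by
        have : Antitone fun n : ℕ => A (PiNat.res σ n) :=
          antitone_nat_of_succ_le fun k => hanti _ _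
        exact this hm
      exact fun x hx => hball ((hdiam' σ n x (hsub hx) _ (hφ σ (n + 1))).trans_lt hn)
    obtain ⟨n, hn⟩ := key σ O hO hσ
    obtain ⟨n', hn'⟩ := key τ O' hO' hτ
    let m := max n n'
    -- By continuity and shrinking diameters, different values along two branches would separate the
    -- images at some finite level.
    refine (hgood m).2 (sigmaInjFamily_of_disjoint ⟨PiNat.res σ m, PiNat.res_length _ _⟩
      ⟨PiNat.res τ m, PiNat.res_length _ _⟩ O hO.measurableSet ?_ ?_)
    · simpa only [A, PiNat.res_length] using hn m (le_max_left _ _)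
    · have := hn' m (le_max_right _ _)
      simp only [A, PiNat.res_length] at this
      exact disjoint_left.2 fun x hx hxO => disjoint_left.1 hOO hxO (this hx)

/-- The **Lusin–Novikov theorem**: a measurable function with countable fibres is injective on
each piece of a countable measurable partition. -/
theorem exists_measurable_nat_injOn_of_countable_fibres {X Z : Type*} [MeasurableSpace X]
    [StandardBorelSpace X] [MeasurableSpace Z] [StandardBorelSpace Z] {f : X → Z}
    (hf : Measurable f) (hc : ∀ z, (f ⁻¹' {z}).Countable) :
    ∃ N : X → ℕ, Measurable N ∧ ∀ x y, f x = f y → N x = N y → x = y := by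
  classical
  let _ := upgradeStandardBorel X
  let _ := upgradeStandardBorel Z
  have hborel : ‹MeasurableSpace X› = borel X := BorelSpace.measurable_eq
  have hpX : PolishSpace X := inferInstance
  have hsig : SigmaInjOn f univ := by
    obtain ⟨t', ht', hcont, hpol⟩ := hf.exists_continuous
    have hB : @BorelSpace X t' _ :=
      @BorelSpace.mk _ _ _ (hborel.trans (borel_eq_borel_of_le hpol hpX ht').symm)
    by_contra hbig
    let _ := t'
    let _ := TopologicalSpace.upgradeIsCompletelyMetrizable X
    obtain ⟨φ, hφ, hφf⟩ := exists_cantor_fibre_of_not_sigmaInjOn hcont hbig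
    have h1 : (range φ).Countable :=
      (hc (f (φ fun _ => true))).mono (range_subset_iff.2 fun σ => hφf _ _)
    have h2 : Countable (ℕ → Bool) := by
      have := h1.to_subtype
      exact (rangeFactorization_injective.2 hφ).countable
    have h3 : Countable (Set ℕ) :=
      (Equiv.arrowCongr (Equiv.refl ℕ) Equiv.propEquivBool).countable_iff.2 h2
    obtain ⟨g, hg⟩ := h3.exists_injective_nat
    exact Function.cantor_injective g hg
  obtain ⟨C, hCm, hCi, hC⟩ := hsig
  have hex : ∀ x, ∃ n, x ∈ C n := fun x => mem_iUnion.1 (hC (mem_univ x))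
  refine ⟨fun x => Nat.find (hex x), measurable_find hex fun k => hCm k, fun x y hxy hN => ?_⟩
  have h1 := Nat.find_spec (hex x)
  have h2 := Nat.find_spec (hex y)
  dsimp only at hN
  rw [← hN] at h2
  exact hCi _ h1 h2 hxy

end LusinNovikov

/-! ### Borel coordinates for a smooth pair. -/

section Coordinates
open Set MeasureTheory

theorem Measurable.encard_of_pred {Ω : Type*} [MeasurableSpace Ω] {P : Ω → ℕ → Prop}
    (hP : ∀ k, MeasurableSet {ω | P ω k}) : Measurable fun ω => {k | P ω k}.encard :=
  measurable_encard.comp (measurable_set_iff.2 fun k => measurableSet_setOfPred.1 (hP k))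

theorem exists_count_eq_of_lt_count (p : ℕ → Prop) [DecidablePred p] {k a : ℕ}
    (h : k < Nat.count p a) : ∃ n, p n ∧ Nat.count p n = k := by
  induction a with
  | zero => simp at h
  | succ a ih =>
    by_cases hk : k < Nat.count p a
    · exact ih hk
    · rw [Nat.count_succ] at h
      split_ifs at h with hp
      · exact ⟨a, hp, by omega⟩
      · omega

/-- Measurable coordinates for a pair `E ⊆ F` of equivalence relations: `base` determines the
`F`-class, `base` and `row` the `E`-class, and `rank` enumerates each `E`-class along an initial
segment of `ℕ`. -/
structure BorelCoordinates {X : Type*} [MeasurableSpace X] (E F : Setoid X) (Z : Type*)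
    [MeasurableSpace Z] where
  base : X → Z
  row : X → ℕ
  rank : X → ℕ
  measurable_base : Measurable base
  measurable_row : Measurable row
  measurable_rank : Measurable rank
  large_iff : ∀ x y, F x y ↔ base x = base y
  small_iff : ∀ x y, E x y ↔ base x = base y ∧ row x = row y
  eq_of_eq : ∀ x y, base x = base y → row x = row y → rank x = rank y → x = y
  exists_rank_eq : ∀ x k, k < rank x → ∃ y, E x y ∧ rank y = k

/-- Lusin–Novikov labels each `F`-class injectively by naturals. The row of `x` is the least label
in its `E`-class, the rank of `x` the number of labels in that class below its own. -/
theorem exists_borelCoordinates {X : Type*} [MeasurableSpace X] [StandardBorelSpace X]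
    (E F : Setoid X) (hEF : ∀ x y, E x y → F x y) (hE : IsSmoothRel E) (hF : IsSmoothRel F)
    (hFc : HasCountableClasses F) :
    ∃ (Z : Type) (_ : MeasurableSpace Z) (_ : StandardBorelSpace Z),
      Nonempty (BorelCoordinates E F Z) := by
  classical
  obtain ⟨Z, _, _, g, hg, hgF⟩ := hF
  obtain ⟨Z', _, _, g', hg', hgE⟩ := hE
  obtain ⟨N, hN, hNinj⟩ := exists_measurable_nat_injOn_of_countable_fibres hg (fun z => by
    rcases (g ⁻¹' {z}).eq_empty_or_nonempty with h | ⟨x, hx⟩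
    · rw [h]
      exact countable_empty
    · refine (hFc {y | F y x} ⟨x, rfl⟩).mono fun y hy => (hgF y x).2 ?_
      exact (show g y = z from hy).trans (show g x = z from hx).symm)
  let B : X → ℕ → Prop := fun x n => ∃ y, N y = n ∧ E x y
  have hB : ∀ n, MeasurableSet {x | B x n} := by
    intro n
    have hm : MeasurableSet {p : X × X | N p.2 = n ∧ g' p.1 = g' p.2} :=
      ((hN.comp measurable_snd) (measurableSet_singleton n)).inter
        (measurableSet_eq_fun (hg'.comp measurable_fst) (hg'.comp measurable_snd))
    have heq : {x | B x n} = Prod.fst '' {p : X × X | N p.2 = n ∧ g' p.1 = g' p.2} := by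
      ext x
      constructor
      · rintro ⟨y, h1, h2⟩
        exact ⟨(x, y), ⟨h1, (hgE x y).1 h2⟩, rfl⟩
      · rintro ⟨⟨x, y⟩, ⟨h1, h2⟩, rfl⟩
        exact ⟨y, h1, (hgE x y).2 h2⟩
    rw [heq]
    -- The projection is injective here, since an `F`-class has at most one point labelled `n`; so
    -- its image is Borel, not merely analytic.
    refine hm.image_of_measurable_injOn measurable_fst ?_
    rintro ⟨x, y⟩ ⟨h1, h2⟩ ⟨x', y'⟩ ⟨h1', h2'⟩ hx
    dsimp only at h1 h2 h1' h2' hx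
    subst hx
    have : y = y' := hNinj y y' ((hgF _ _).1 (hEF _ _ ((hgE _ _).2 (h2.symm.trans h2'))))
      (h1.trans h1'.symm)
    rw [this]
  have hself : ∀ x, B x (N x) := fun x => ⟨x, rfl, E.refl x⟩
  have hcongr : ∀ x y, E x y → B x = B y := fun x y h => by
    funext n
    refine propext ⟨fun ⟨w, h1, h2⟩ => ⟨w, h1, E.trans (E.symm h) h2⟩,
      fun ⟨w, h1, h2⟩ => ⟨w, h1, E.trans h h2⟩⟩
  have hex : ∀ x, ∃ n, B x n := fun x => ⟨_, hself x⟩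
  have hsmall : ∀ x y, E x y ↔ g x = g y ∧ Nat.find (hex x) = Nat.find (hex y) := by
    intro x y
    constructor
    · intro h
      refine ⟨(hgF _ _).1 (hEF _ _ h), le_antisymm (Nat.find_min' _ ?_) (Nat.find_min' _ ?_)⟩
      · rw [hcongr x y h]
        exact Nat.find_spec (hex y)
      · rw [← hcongr x y h]
        exact Nat.find_spec (hex x)
    · rintro ⟨h1, h2⟩
      obtain ⟨a, ha, hxa⟩ := Nat.find_spec (hex x)
      obtain ⟨b, hb, hyb⟩ := Nat.find_spec (hex y)
      have hab : a = b := by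
        refine hNinj a b ?_ (by rw [ha, hb, h2])
        rw [← (hgF _ _).1 (hEF _ _ hxa), ← (hgF _ _).1 (hEF _ _ hyb), h1]
      subst hab
      exact E.trans hxa (E.symm hyb)
  refine ⟨Z, ‹_›, ‹_›, ⟨⟨g, fun x => Nat.find (hex x), fun x => Nat.count (B x) (N x), hg,
    measurable_find hex hB, ?_, hgF, hsmall, fun x y h1 h2 h3 => ?_, fun x k hk => ?_⟩⟩⟩
  · have hcount : ∀ n, Measurable fun x => Nat.count (B x) n := by
      intro n
      induction n with
      | zero => simp
      | succ n ih =>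
        simp only [Nat.count_succ]
        exact ih.add (Measurable.ite (hB n) measurable_const measurable_const)
    exact (measurable_from_prod_countable_left (f := fun p : X × ℕ => Nat.count (B p.1) p.2)
      hcount).comp (measurable_id.prodMk hN)
  · have hE' := (hsmall x y).2 ⟨h1, h2⟩
    refine hNinj x y h1 (Nat.count_injective (p := B x) (hself x) ?_ ?_)
    · rw [hcongr x y hE']
      exact hself y
    · simpa only [hcongr x y hE'] using h3
  · obtain ⟨n, ⟨y, rfl, hxy⟩, hn⟩ := exists_count_eq_of_lt_count _ hk
    exact ⟨y, hxy, by simpa only [hcongr x y hxy] using hn⟩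

namespace BorelCoordinates

variable {X Z : Type*} [MeasurableSpace X] [MeasurableSpace Z] {E F : Setoid X}

/-- The number of elements of the `E`-class with coordinates `z` and `i`. -/
noncomputable def size (c : BorelCoordinates E F Z) (z : Z) (i : ℕ) : ℕ∞ :=
  {k | ∃ x, c.base x = z ∧ c.row x = i ∧ c.rank x = k}.encard

theorem injective (c : BorelCoordinates E F Z) :
    Function.Injective fun x => (c.base x, c.row x, c.rank x) := fun x y h => by
  simp only [Prod.mk.injEq] at h
  exact c.eq_of_eq x y h.1 h.2.1 h.2.2

theorem measurableEmbedding [StandardBorelSpace X] [StandardBorelSpace Z]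
    (c : BorelCoordinates E F Z) :
    MeasurableEmbedding fun x => (c.base x, c.row x, c.rank x) :=
  (c.measurable_base.prodMk (c.measurable_row.prodMk c.measurable_rank)).measurableEmbedding
    c.injective

theorem measurable_size [StandardBorelSpace X] [StandardBorelSpace Z]
    (c : BorelCoordinates E F Z) (i : ℕ) : Measurable fun z => c.size z i := by
  refine Measurable.encard_of_pred fun k => ?_
  have : {z | ∃ x, c.base x = z ∧ c.row x = i ∧ c.rank x = k} =
      (fun z : Z => (z, i, k)) ⁻¹' range fun x => (c.base x, c.row x, c.rank x) := by
    ext z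
    simp
  rw [this]
  exact measurable_prodMk_right c.measurableEmbedding.measurableSet_range

theorem measurableSet_range_base [StandardBorelSpace X] [StandardBorelSpace Z]
    (c : BorelCoordinates E F Z) : MeasurableSet (range c.base) := by
  have : range c.base = ⋃ (i : ℕ) (k : ℕ),
      (fun z : Z => (z, i, k)) ⁻¹' range fun x => (c.base x, c.row x, c.rank x) := by
    ext z
    simp only [mem_range, mem_iUnion, mem_preimage, Prod.mk.injEq]
    exact ⟨fun ⟨x, hx⟩ => ⟨_, _, x, hx, rfl, rfl⟩, fun ⟨_, _, x, hx, _⟩ => ⟨x, hx⟩⟩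
  rw [this]
  exact .iUnion fun i => .iUnion fun k =>
    measurable_prodMk_right c.measurableEmbedding.measurableSet_range

theorem encard_row (c : BorelCoordinates E F Z) (z : Z) (i : ℕ) :
    {y : {x | c.base x = z} | c.row y = i}.encard = c.size z i := by
  have hinj : InjOn (fun y : {x | c.base x = z} => c.rank y) {y | c.row y = i} :=
    fun x hx y hy h => Subtype.ext (c.eq_of_eq x y (x.2.trans y.2.symm)
      ((show c.row x = i from hx).trans (show c.row y = i from hy).symm) h)
  rw [← hinj.encard_image, size]
  congr 1
  ext k
  constructor
  · rintro ⟨y, h1, h2⟩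
    exact ⟨y, y.2, h1, h2⟩
  · rintro ⟨x, h0, h1, h2⟩
    exact ⟨⟨x, h0⟩, h1, h2⟩

/-- As `1 ≤ m`, the rows counted are nonempty, and nonempty rows correspond bijectively to
`E`-classes in the fibre. -/
theorem localCoarseShape_eq (c : BorelCoordinates E F Z) (z : Z) (m : ShapeIndex) :
    localCoarseShape E {x | c.base x = z} m = {i | m.1 ≤ c.size z i}.encard := by
  let φ : ℕ → Set {x | c.base x = z} := fun i => {y | c.row y = i}
  have hinj : InjOn φ {i | m.1 ≤ c.size z i} := by
    intro i hi j _ hij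
    have : (φ i).Nonempty := by
      rw [← one_le_encard_iff_nonempty, encard_row]
      exact m.2.trans hi
    obtain ⟨y, hy⟩ := this
    have hy' : y ∈ φ j := hij ▸ hy
    exact (show c.row y = i from hy).symm.trans hy'
  rw [← hinj.encard_image]
  unfold localCoarseShape countableCoarseShape
  congr 1
  have hclass : ∀ y : {x | c.base x = z},
      {x | restrictRel E {x | c.base x = z} x y} = φ (c.row y) := by
    intro y
    ext x
    change E x y ↔ c.row x = c.row y
    rw [c.small_iff, and_iff_right (x.2.trans y.2.symm)]
  ext s
  constructor
  · rintro ⟨⟨y, rfl⟩, hm⟩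
    rw [hclass, encard_row] at hm
    exact ⟨c.row y, hm, (hclass y).symm⟩
  · rintro ⟨i, hi, rfl⟩
    have hi' : m.1 ≤ (φ i).encard := by
      rw [encard_row]
      exact hi
    refine ⟨?_, hi'⟩
    obtain ⟨y, rfl⟩ := one_le_encard_iff_nonempty.1 (m.2.trans hi')
    exact ⟨y, (hclass y).symm⟩

theorem exists_of_lt_size (c : BorelCoordinates E F Z) {z : Z} {i k : ℕ}
    (h : (k : ℕ∞) < c.size z i) : ∃ x, c.base x = z ∧ c.row x = i ∧ c.rank x = k := by
  by_contra hcon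
  have hsub : {k | ∃ x, c.base x = z ∧ c.row x = i ∧ c.rank x = k} ⊆ (Finset.range k : Set ℕ) := by
    rintro l ⟨x, h0, h1, rfl⟩
    simp only [Finset.coe_range, mem_Iio]
    by_contra! hl
    rcases hl.eq_or_lt with rfl | hl
    · exact hcon ⟨x, h0, h1, rfl⟩
    · obtain ⟨y, hxy, hy⟩ := c.exists_rank_eq x k hl
      obtain ⟨e0, e1⟩ := (c.small_iff x y).1 hxy
      exact hcon ⟨y, e0 ▸ h0, e1 ▸ h1, hy⟩
  have := encard_le_encard hsub
  rw [encard_coe_eq_coe_finsetCard, Finset.card_range] at this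
  exact absurd h (not_lt.2 this)

theorem rank_lt_size (c : BorelCoordinates E F Z) (x : X) :
    (c.rank x : ℕ∞) < c.size (c.base x) (c.row x) := by
  have hsub : (Finset.range (c.rank x + 1) : Set ℕ) ⊆
      {k | ∃ y, c.base y = c.base x ∧ c.row y = c.row x ∧ c.rank y = k} := by
    intro k hk
    simp only [Finset.coe_range, mem_Iio, Nat.lt_succ_iff] at hk
    rcases hk.eq_or_lt with rfl | hk
    · exact ⟨x, rfl, rfl, rfl⟩
    · obtain ⟨y, hxy, hy⟩ := c.exists_rank_eq x k hk
      obtain ⟨e0, e1⟩ := (c.small_iff x y).1 hxy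
      exact ⟨y, e0.symm, e1.symm, hy⟩
  have := encard_le_encard hsub
  rw [encard_coe_eq_coe_finsetCard, Finset.card_range] at this
  exact lt_of_lt_of_le (by exact_mod_cast Nat.lt_succ_self _) this

end BorelCoordinates

end Coordinates

/-! ### Marriage for countable families. -/

section Matching
open Set

theorem exists_injective_mem_of_infinite {I J : Type*} [Countable I] (S : I → Set J)
    (hS : ∀ i, (S i).Infinite) : ∃ φ : I → J, φ.Injective ∧ ∀ i, φ i ∈ S i := by
  classical
  rcases isEmpty_or_nonempty I with hI | hI
  · exact ⟨isEmptyElim, fun i => isEmptyElim i, isEmptyElim⟩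
  obtain ⟨u, hu⟩ := exists_surjective_nat I
  choose pick hpick hpick' using fun (n : ℕ) (s : Finset J) => (hS (u n)).exists_notMem_finset s
  let h : ℕ → Finset J := fun n => Nat.rec ∅ (fun n s => insert (pick n s) s) n
  have hmono : Monotone h := monotone_nat_of_le_succ fun n => Finset.subset_insert _ _
  have hne : ∀ m n, m < n → pick m (h m) ≠ pick n (h n) := fun m n hmn heq =>
    hpick' n (h n) (heq ▸ hmono (Nat.succ_le_of_lt hmn) (Finset.mem_insert_self _ _))
  refine ⟨fun i => pick (Function.surjInv hu i) (h (Function.surjInv hu i)), fun i j hij => ?_,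
    fun i => ?_⟩
  · apply Function.injective_surjInv hu
    rcases lt_trichotomy (Function.surjInv hu i) (Function.surjInv hu j) with hlt | heq | hlt
    · exact (hne _ _ hlt hij).elim
    · exact heq
    · exact (hne _ _ hlt hij.symm).elim
  · have := hpick (Function.surjInv hu i) (h (Function.surjInv hu i))
    rwa [Function.surjInv_eq hu] at this

/-- A marriage theorem for families labelled by a well-quasi-order. -/
theorem exists_injective_le_of_encard_le {P I J : Type*} [Preorder P] [WellQuasiOrderedLE P]
    [Countable I] (p : I → P) (q : J → P)
    (h : ∀ W : Set P, IsUpperSet W → {i | p i ∈ W}.encard ≤ {j | q j ∈ W}.encard) :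
    ∃ φ : I → J, φ.Injective ∧ ∀ i, p i ≤ q (φ i) := by
  classical
  let W₀ : Set P := {a | {j | a ≤ q j}.Finite}
  have hW₀ : IsUpperSet W₀ := fun a b hab ha =>
    Set.Finite.subset ha fun j (hj : b ≤ q j) => hab.trans hj
  -- An infinite set would contain a monotone sequence, so its first label would have infinitely
  -- many targets above it.
  have hJ : {j | q j ∈ W₀}.Finite := by
    by_contra hinf
    let e := Set.Infinite.natEmbedding _ hinf
    obtain ⟨g, hg⟩ := (wellQuasiOrdered_le (α := P)).exists_monotone_subseq fun n => q (e n)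
    have hfin : {j | q (e (g 0)) ≤ q j}.Finite := (e (g 0)).2
    refine (Set.infinite_range_of_injective
      (f := fun n => (e (g n) : J)) fun m n hmn => ?_) (hfin.subset ?_)
    · exact g.injective (e.injective (Subtype.ext hmn))
    · rintro _ ⟨n, rfl⟩
      exact hg 0 n (Nat.zero_le n)
  obtain ⟨φ₀, hφ₀, hφ₀'⟩ := (Finset.all_card_le_biUnion_card_iff_exists_injective
    (fun i : {i // p i ∈ W₀} => (show {j | p i ≤ q j}.Finite from i.2).toFinset)).1 (by
      intro s
      -- Hall's condition for `s` is the hypothesis for the upper set generated by the labels of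
      -- `s`.
      have hW := h {a | ∃ i ∈ s, p i ≤ a} fun a b hab ⟨i, hi, hia⟩ => ⟨i, hi, hia.trans hab⟩
      have h1 : ((s.map (Function.Embedding.subtype _) : Finset I) : Set I) ⊆
          {i | p i ∈ {a | ∃ i ∈ s, p i.1 ≤ a}} := by
        intro i hi
        simp only [Finset.coe_map, Function.Embedding.subtype_apply, mem_image] at hi
        obtain ⟨i, hi, rfl⟩ := hi
        exact ⟨i, hi, le_rfl⟩
      have h2 : {j | q j ∈ {a | ∃ i ∈ s, p i.1 ≤ a}} = (s.biUnion fun i : {i // p i ∈ W₀} =>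
          (show {j | p i ≤ q j}.Finite from i.2).toFinset : Set J) := by
        ext j
        simp
      have h3 := (encard_le_encard h1).trans hW
      rw [h2, encard_coe_eq_coe_finsetCard, encard_coe_eq_coe_finsetCard,
        Finset.card_map] at h3
      exact_mod_cast h3)
  -- Discarding the finitely many targets labelled in `W₀` keeps the greedy part disjoint from the
  -- Hall part.
  obtain ⟨φ₁, hφ₁, hφ₁'⟩ := exists_injective_mem_of_infinite
    (fun i : {i // p i ∉ W₀} => {j | p i ≤ q j} \ {j | q j ∈ W₀})
    fun i => Set.Infinite.sdiff i.2 hJ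
  have hφ₀'' : ∀ i, p i.1 ≤ q (φ₀ i) := fun i => by simpa using hφ₀' i
  have hmem : ∀ i, q (φ₀ i) ∈ W₀ := fun i => hW₀ (hφ₀'' i) i.2
  refine ⟨fun i => if hi : p i ∈ W₀ then φ₀ ⟨i, hi⟩ else φ₁ ⟨i, hi⟩, fun i j hij => ?_,
    fun i => ?_⟩
  · dsimp only at hij
    split_ifs at hij with h1 h2 h2
    · exact congrArg Subtype.val (hφ₀ hij)
    · exact ((hφ₁' ⟨j, h2⟩).2 (hij ▸ hmem ⟨i, h1⟩)).elim
    · exact ((hφ₁' ⟨i, h1⟩).2 (hij ▸ hmem ⟨j, h2⟩)).elim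
    · exact congrArg Subtype.val (hφ₁ hij)
  · dsimp only
    split_ifs with hi
    · exact hφ₀'' ⟨i, hi⟩
    · exact (hφ₁' ⟨i, hi⟩).1

end Matching

/-! ### Shapes form a countable well-quasi-order. -/

section ShapeOrder
open Set

/-- The shape with infinitely many classes of each size less than `p.1`, and, beyond that, classes
of the sizes listed in `p.2`. -/
noncomputable def shapeOfCode (p : WithTop ℕ∞ × List ℕ∞) : ShapeIndex → ℕ∞ := fun m =>
  open Classical in
  if WithTop.some m.1 < p.1 then ⊤ else (p.2.countP (fun a => m.1 ≤ a) : ℕ)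

theorem shapeOfCode_mono {p q : WithTop ℕ∞ × List ℕ∞} (h1 : p.1 ≤ q.1)
    (h2 : List.SublistForall₂ (· ≤ ·) p.2 q.2) : shapeOfCode p ≤ shapeOfCode q := by
  classical
  intro m
  unfold shapeOfCode
  by_cases hq : WithTop.some m.1 < q.1
  · simp [hq]
  · rw [if_neg hq, if_neg fun hp => hq (hp.trans_le h1)]
    have : ∀ {l l' : List ℕ∞}, List.SublistForall₂ (· ≤ ·) l l' →
        l.countP (fun a => m.1 ≤ a) ≤ l'.countP (fun a => m.1 ≤ a) := by
      intro l l' h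
      induction h with
      | nil => simp
      | @cons a b _ _ hab _ ih =>
        rw [List.countP_cons, List.countP_cons]
        have : (if decide (m.1 ≤ a) = true then 1 else 0) ≤
            if decide (m.1 ≤ b) = true then 1 else 0 := by
          by_cases ha : m.1 ≤ a
          · simp [ha, ha.trans hab]
          · simp [ha]
        omega
      | @cons_right a _ _ _ ih =>
        rw [List.countP_cons]
        omega
    exact Nat.cast_le.2 (this h2)

/-- At the least size `m₀` where the count is finite, only finitely many classes remain; their sizes
form the list. The extra top of `WithTop ℕ∞` serves shapes with infinitely many infinite classes. -/
theorem exists_shapeOfCode_eq {α : ShapeIndex → ℕ∞} (hα : α ∈ LocalCoarseShapes) :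
    ∃ p, shapeOfCode p = α := by
  classical
  obtain ⟨A, _, _, r, rfl⟩ := hα
  by_cases htop : ∀ m, countableCoarseShape r m = ⊤
  · refine ⟨(⊤, []), funext fun m => ?_⟩
    rw [htop m, shapeOfCode, if_pos (WithTop.coe_lt_top _)]
  · push Not at htop
    obtain ⟨m₀, hm₀, hmin⟩ := wellFounded_lt.has_min
      {m : ShapeIndex | countableCoarseShape r m ≠ ⊤} htop
    have hfin : {c : Set A | c ∈ r.classes ∧ m₀.1 ≤ c.encard}.Finite := encard_ne_top_iff.1 hm₀
    refine ⟨(WithTop.some m₀.1, hfin.toFinset.toList.map encard), funext fun m => ?_⟩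
    change (if WithTop.some m.1 < WithTop.some m₀.1 then ⊤ else _) = _
    by_cases hm : m.1 < m₀.1
    · rw [if_pos (WithTop.coe_lt_coe.2 hm)]
      exact (not_not.1 fun h => hmin m h hm).symm
    · rw [if_neg fun h => hm (WithTop.coe_lt_coe.1 h)]
      unfold countableCoarseShape
      have : {c : Set A | c ∈ r.classes ∧ m.1 ≤ c.encard} =
          (hfin.toFinset.filter fun c => m.1 ≤ c.encard : Finset (Set A)) := by
        ext c
        simp only [mem_ofPred_eq, Finset.coe_filter, Finite.mem_toFinset]
        exact ⟨fun h => ⟨⟨h.1, (not_lt.1 hm).trans h.2⟩, h.2⟩, fun h => ⟨h.1.1, h.2⟩⟩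
      rw [this, encard_coe_eq_coe_finsetCard, List.countP_map, Finset.card_def, Finset.filter_val,
        ← Multiset.countP_eq_card_filter, ← Finset.coe_toList, Multiset.coe_countP]
      rfl

instance : Countable LocalCoarseShapes := by
  choose code hcode using fun α : LocalCoarseShapes => exists_shapeOfCode_eq α.2
  exact Function.Injective.countable (f := code) fun α β h =>
    Subtype.ext (by rw [← hcode α, ← hcode β, h])

/-- Thresholds are well-ordered and lists are well-quasi-ordered by Higman's lemma; the decoding is
monotone on the product. -/
instance : WellQuasiOrderedLE LocalCoarseShapes := by
  choose code hcode using fun α : LocalCoarseShapes => exists_shapeOfCode_eq α.2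
  have hlist : WellQuasiOrdered (List.SublistForall₂ ((· ≤ ·) : ℕ∞ → ℕ∞ → Prop)) := by
    have := Set.PartiallyWellOrderedOn.partiallyWellOrderedOn_sublistForall₂
      ((· ≤ ·) : ℕ∞ → ℕ∞ → Prop) (s := univ) (fun f => wellQuasiOrdered_le fun n => (f n).1)
    exact fun f => this fun n => ⟨f n, fun _ _ => trivial⟩
  refine ⟨fun f => ?_⟩
  obtain ⟨m, n, hmn, h1, h2⟩ :=
    ((wellQuasiOrdered_le (α := WithTop ℕ∞)).prod hlist) fun n => code (f n)
  refine ⟨m, n, hmn, ?_⟩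
  change (f m).1 ≤ (f n).1
  rw [← hcode (f m), ← hcode (f n)]
  exact shapeOfCode_mono h1 h2

end ShapeOrder

/-! ### Borel choice of matchings. -/

section MeasurableMatching
open Set MeasureTheory

/-- For each `m ≥ 1`, at least as many terms of `b` as of `a` are at least `m`. -/
def CountDominated (a b : ℕ → ℕ∞) : Prop :=
  ∀ m : ℕ∞, 1 ≤ m → {i | m ≤ a i}.encard ≤ {j | m ≤ b j}.encard

/-- Nonempty upper sets of the well-order `ℕ∞` are final segments, so domination is the marriage
condition; dropping zero terms of `a` allows the threshold to be raised to `max m 1`. -/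
theorem CountDominated.exists_matching {a b : ℕ → ℕ∞} (h : CountDominated a b) :
    ∃ ψ : {i // 1 ≤ a i} → ℕ, ψ.Injective ∧ ∀ i : {i // 1 ≤ a i}, a i ≤ b (ψ i) := by
  refine exists_injective_le_of_encard_le (fun i : {i // 1 ≤ a i} => a i) b fun W hW => ?_
  rcases W.eq_empty_or_nonempty with rfl | hne
  · simp
  · obtain ⟨m, hm, hmin⟩ := wellFounded_lt.has_min W hne
    have hW' : ∀ k, k ∈ W ↔ m ≤ k := fun k => ⟨fun hk => not_lt.1 (hmin k hk), fun hk => hW hk hm⟩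
    calc {i : {i // 1 ≤ a i} | a i ∈ W}.encard ≤ {i | max m 1 ≤ a i}.encard :=
          encard_le_encard_of_injOn (f := Subtype.val)
            (fun i hi => max_le ((hW' _).1 hi) i.2) Subtype.val_injective.injOn
      _ ≤ {j | max m 1 ≤ b j}.encard := h _ (le_max_right _ _)
      _ ≤ {j | b j ∈ W}.encard :=
          encard_le_encard fun j hj => (hW' _).2 ((le_max_left _ _).trans hj)

open Classical in
/-- Replace the term of index `v` by `0`, unless `k = 0`. -/
noncomputable def removeTerm (b : ℕ → ℕ∞) (k : ℕ∞) (v : ℕ) : ℕ → ℕ∞ :=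
  fun j => if j = v ∧ 1 ≤ k then 0 else b j

/-- Take `v` to be the partner of `0` in a full matching; the rest of that matching witnesses the
remaining domination. If `a 0 = 0`, nothing is removed and `v` is arbitrary. -/
theorem CountDominated.exists_step {a b : ℕ → ℕ∞} (h : CountDominated a b) :
    ∃ v, (1 ≤ a 0 → a 0 ≤ b v) ∧
      CountDominated (fun i => a (i + 1)) (removeTerm b (a 0) v) := by
  classical
  obtain ⟨ψ, hψ, hab⟩ := h.exists_matching
  refine ⟨if h : 1 ≤ a 0 then ψ ⟨0, h⟩ else 0, fun h0 => ?_, fun m hm => ?_⟩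
  · simpa only [dif_pos h0] using hab ⟨0, h0⟩
  · refine encard_le_encard_of_injOn
      (f := fun i => if h : 1 ≤ a (i + 1) then ψ ⟨i + 1, h⟩ else 0) ?_ ?_
    · intro i (hi : m ≤ a (i + 1))
      have hi1 := hm.trans hi
      simp only [dif_pos hi1, mem_ofPred_eq, removeTerm]
      rw [if_neg]
      · exact hi.trans (hab _)
      · rintro ⟨heq, h0⟩
        rw [dif_pos h0] at heq
        have := congrArg Subtype.val (hψ heq)
        simp at this
    · intro i (hi : m ≤ a (i + 1)) j (hj : m ≤ a (j + 1)) hij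
      simp only [dif_pos (hm.trans hi), dif_pos (hm.trans hj)] at hij
      have := congrArg Subtype.val (hψ hij)
      simpa using this

variable {Ω : Type*} [MeasurableSpace Ω]

theorem measurableSet_countDominated {s t : Ω → ℕ → ℕ∞} (hs : ∀ i, Measurable fun ω => s ω i)
    (ht : ∀ i, Measurable fun ω => t ω i) : MeasurableSet {ω | CountDominated (s ω) (t ω)} := by
  have : {ω | CountDominated (s ω) (t ω)} = ⋂ (m : ℕ∞) (_ : 1 ≤ m),
      (fun ω => ({i | m ≤ s ω i}.encard, {j | m ≤ t ω j}.encard)) ⁻¹' {p | p.1 ≤ p.2} := by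
    ext ω
    simp [CountDominated]
  rw [this]
  refine .iInter fun m => .iInter fun _ => ?_
  refine (Measurable.prodMk (.encard_of_pred fun i => ?_) (.encard_of_pred fun i => ?_)) .of_discrete
  · exact hs i (.of_discrete (s := Ici m))
  · exact ht i (.of_discrete (s := Ici m))

theorem measurable_removeTerm {k : Ω → ℕ∞} {t : Ω → ℕ → ℕ∞} {v : Ω → ℕ} (hk : Measurable k)
    (ht : ∀ i, Measurable fun ω => t ω i) (hv : Measurable v) (j : ℕ) :
    Measurable fun ω => removeTerm (t ω) (k ω) (v ω) j := by
  classical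
  refine Measurable.ite ?_ measurable_const (ht j)
  exact (hv (.of_discrete (s := {l | j = l}))).inter (hk (.of_discrete (s := Ici 1)))

theorem exists_measurable_step {s t : Ω → ℕ → ℕ∞} (hs : ∀ i, Measurable fun ω => s ω i)
    (ht : ∀ i, Measurable fun ω => t ω i) (h : ∀ ω, CountDominated (s ω) (t ω)) :
    ∃ v : Ω → ℕ, Measurable v ∧ ∀ ω, (1 ≤ s ω 0 → s ω 0 ≤ t ω (v ω)) ∧
      CountDominated (fun i => s ω (i + 1)) (removeTerm (t ω) (s ω 0) (v ω)) := by
  classical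
  have hex := fun ω => (h ω).exists_step
  refine ⟨fun ω => Nat.find (hex ω), measurable_find hex fun k => ?_,
    fun ω => Nat.find_spec (hex ω)⟩
  refine MeasurableSet.inter ?_ (measurableSet_countDominated (fun i => hs (i + 1))
    (measurable_removeTerm (hs 0) ht measurable_const))
  exact ((hs 0).prodMk (ht k))
    (.of_discrete (s := {p : ℕ∞ × ℕ∞ | 1 ≤ p.1 → p.1 ≤ p.2}))

/-- Matchings between count-dominated sequences can be chosen measurably. -/
theorem exists_measurable_matching {s t : Ω → ℕ → ℕ∞} (hs : ∀ i, Measurable fun ω => s ω i)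
    (ht : ∀ i, Measurable fun ω => t ω i) (h : ∀ ω, CountDominated (s ω) (t ω)) :
    ∃ φ : Ω → ℕ → ℕ, (∀ i, Measurable fun ω => φ ω i) ∧
      (∀ ω i, 1 ≤ s ω i → s ω i ≤ t ω (φ ω i)) ∧
      ∀ ω i j, 1 ≤ s ω i → 1 ≤ s ω j → φ ω i = φ ω j → i = j := by
  let State := {p : (Ω → ℕ → ℕ∞) × (Ω → ℕ → ℕ∞) // (∀ i, Measurable fun ω => p.1 ω i) ∧
    (∀ i, Measurable fun ω => p.2 ω i) ∧ ∀ ω, CountDominated (p.1 ω) (p.2 ω)}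
  choose v hv hv' using fun p : State => exists_measurable_step p.2.1 p.2.2.1 p.2.2.2
  let next : State → State := fun p =>
    ⟨(fun ω i => p.1.1 ω (i + 1), fun ω => removeTerm (p.1.2 ω) (p.1.1 ω 0) (v p ω)),
      fun i => p.2.1 (i + 1), measurable_removeTerm (p.2.1 0) p.2.2.1 (hv p),
      fun ω => (hv' p ω).2⟩
  let st : ℕ → State := fun n => next^[n] ⟨(s, t), hs, ht, h⟩
  have hst : ∀ n, st (n + 1) = next (st n) := fun n => Function.iterate_succ_apply' _ _ _
  have hs_eq : ∀ n ω i, (st n).1.1 ω i = s ω (i + n) := by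
    intro n
    induction n with
    | zero => exact fun ω i => rfl
    | succ n ih =>
      intro ω i
      rw [hst]
      change (st n).1.1 ω (i + 1) = _
      rw [ih, add_right_comm, add_assoc]
  have hs0 : ∀ n ω, (st n).1.1 ω 0 = s ω n := fun n ω => by rw [hs_eq, zero_add]
  have hanti : ∀ ω j, Antitone fun n => (st n).1.2 ω j := by
    refine fun ω j => antitone_nat_of_succ_le fun n => ?_
    rw [hst]
    change removeTerm _ _ _ j ≤ _
    unfold removeTerm
    split_ifs
    · exact zero_le
    · exact le_rfl
  have hle : ∀ n ω, 1 ≤ s ω n → s ω n ≤ (st n).1.2 ω (v (st n) ω) := fun n ω h1 => by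
    have := (hv' (st n) ω).1
    rw [hs0] at this
    exact this h1
  have hne : ∀ m n ω, m < n → 1 ≤ s ω m → 1 ≤ s ω n → v (st m) ω ≠ v (st n) ω := by
    intro m n ω hmn hm hn heq
    -- A used term becomes `0` and terms never grow, so it cannot serve a later nonzero demand.
    have h0 : (st (m + 1)).1.2 ω (v (st m) ω) = 0 := by
      rw [hst]
      change removeTerm _ _ _ _ = 0
      rw [removeTerm, if_pos ⟨rfl, by rwa [hs0]⟩]
    have h1 := (hn.trans (hle n ω hn)).trans (hanti ω _ (Nat.succ_le_of_lt hmn))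
    rw [← heq] at h1
    dsimp only at h1
    rw [h0] at h1
    simp at h1
  refine ⟨fun ω n => v (st n) ω, fun n => hv (st n),
    fun ω n hn => (hle n ω hn).trans (hanti ω _ (Nat.zero_le n)), fun ω i j hi hj hij => ?_⟩
  rcases lt_trichotomy i j with hlt | heq | hlt
  · exact (hne i j ω hlt hi hj hij).elim
  · exact heq
  · exact (hne j i ω hlt hj hi hij.symm).elim

theorem exists_measurable_injective_of_not_countable {I J : Type*} [MeasurableSpace I]
    [StandardBorelSpace I] [MeasurableSpace J] [StandardBorelSpace J] {S : Set J}
    (hS : MeasurableSet S) (hc : ¬ S.Countable) :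
    ∃ θ : I → J, Measurable θ ∧ θ.Injective ∧ ∀ i, θ i ∈ S := by
  have := hS.standardBorel
  let e := PolishSpace.measurableEquivNatBoolOfNotCountable (α := S) hc
  refine ⟨fun i => e.symm (MeasurableSpace.mapNatBool I i),
    measurable_subtype_coe.comp (e.symm.measurable.comp (MeasurableSpace.measurable_mapNatBool I)),
    fun i j hij => ?_, fun i => (e.symm _).2⟩
  exact MeasurableSpace.injective_mapNatBool I (e.symm.injective (Subtype.ext hij))

/-- A measurable marriage theorem for families labelled by a countable well-quasi-order. -/
theorem exists_measurable_injective_le {P I J : Type*} [Preorder P] [WellQuasiOrderedLE P]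
    [Countable P] [MeasurableSpace I] [StandardBorelSpace I] [MeasurableSpace J]
    [StandardBorelSpace J] {p : I → P} {q : J → P} (hp : ∀ a, MeasurableSet (p ⁻¹' {a}))
    (hq : ∀ a, MeasurableSet (q ⁻¹' {a}))
    (h : ∀ W : Set P, IsUpperSet W → Nonempty ({i // p i ∈ W} ↪ {j // q j ∈ W})) :
    ∃ Φ : I → J, Measurable Φ ∧ Φ.Injective ∧ ∀ i, p i ≤ q (Φ i) := by
  classical
  let D : Set P := {a | ¬ {j | a ≤ q j}.Countable}
  -- Countability of `P` enters: countably many countable fibres cannot cover an uncountable set.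
  have hD : ∀ a, a ∈ D → ∃ b, a ≤ b ∧ ¬ (q ⁻¹' {b}).Countable := by
    intro a ha
    by_contra! hcon
    refine ha ((countable_iUnion fun b : {b // a ≤ b} => hcon b.1 b.2).mono fun j hj => ?_)
    exact mem_iUnion.2 ⟨⟨q j, hj⟩, rfl⟩
  choose! β hβ hβ' using hD
  have hDβ : ∀ a ∈ D, β a ∈ D := fun a ha hcon =>
    hβ' a ha (hcon.mono fun j hj => (show q j = β a from hj).ge)
  have hup : IsUpperSet Dᶜ := fun a b hab ha hb =>
    ha fun hcon => hb (hcon.mono fun j hj => hab.trans hj)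
  have hJc : {j | q j ∈ Dᶜ}.Countable := by
    refine (countable_iUnion fun a : (Dᶜ : Set P) => not_not.1 a.2).mono fun j hj => ?_
    exact mem_iUnion.2 ⟨⟨q j, hj⟩, le_rfl⟩
  have hIc : Countable {i // p i ∈ Dᶜ} := by
    have : Countable {j // q j ∈ Dᶜ} := hJc.to_subtype
    exact (h _ hup).some.injective.countable
  obtain ⟨φ, hφ, hφ'⟩ := exists_injective_le_of_encard_le (fun i : {i // p i ∈ Dᶜ} => p i) q (by
    intro W hW
    calc {i : {i // p i ∈ Dᶜ} | p i ∈ W}.encard ≤ {i | p i ∈ W ∩ Dᶜ}.encard :=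
          encard_le_encard_of_injOn (f := Subtype.val) (fun i hi => ⟨hi, i.2⟩)
            Subtype.val_injective.injOn
      _ ≤ {j | q j ∈ W ∩ Dᶜ}.encard := (h _ (hW.inter hup)).some.encard_le
      _ ≤ {j | q j ∈ W}.encard := encard_le_encard fun j hj => hj.1)
  have hφD : ∀ i, q (φ i) ∉ D := fun i => hup (hφ' i) i.2
  have hθ : ∀ b, ∃ θ : I → J, ¬ (q ⁻¹' {b}).Countable →
      Measurable θ ∧ θ.Injective ∧ ∀ i, q (θ i) = b := by
    intro b
    by_cases hb : (q ⁻¹' {b}).Countable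
    · rcases isEmpty_or_nonempty I with hI | ⟨⟨i⟩⟩
      · exact ⟨isEmptyElim, fun h => (h hb).elim⟩
      · have : Nonempty J := by
          obtain ⟨e⟩ := h univ isUpperSet_univ
          exact ⟨e ⟨i, trivial⟩⟩
        exact ⟨fun _ => this.some, fun h => (h hb).elim⟩
    · obtain ⟨θ, h1, h2, h3⟩ := exists_measurable_injective_of_not_countable (I := I) (hq b) hb
      exact ⟨θ, fun _ => ⟨h1, h2, h3⟩⟩
  choose θ hθ using hθ
  -- Each `θ b` is injective on all of `I`, so different labels may share the same `β`. Off `D` only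
  -- countably many indices remain, so `φ` needs no measurability.
  let Φ : I → J := fun i => if hi : p i ∈ D then θ (β (p i)) i else φ ⟨i, hi⟩
  have hpos : ∀ i, p i ∈ D → Φ i = θ (β (p i)) i := fun i hi => dif_pos hi
  have hneg : ∀ i (hi : p i ∉ D), Φ i = φ ⟨i, hi⟩ := fun i hi => dif_neg hi
  have hqΦ : ∀ i, p i ∈ D → q (Φ i) = β (p i) := fun i hi => by
    rw [hpos i hi]
    exact (hθ _ (hβ' _ hi)).2.2 i
  have hiff : ∀ i, q (Φ i) ∈ D ↔ p i ∈ D := by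
    intro i
    by_cases hi : p i ∈ D
    · simp only [hi, hqΦ i hi, hDβ _ hi]
    · simp only [hi, hneg i hi, hφD]
  refine ⟨Φ, fun B hB => ?_, fun i j hij => ?_, fun i => ?_⟩
  · have : Φ ⁻¹' B = ⋃ a, p ⁻¹' {a} ∩ Φ ⁻¹' B := by
      rw [← iUnion_inter, ← preimage_iUnion, iUnion_of_singleton, preimage_univ, univ_inter]
    rw [this]
    refine .iUnion fun a => ?_
    by_cases ha : a ∈ D
    · have heq : p ⁻¹' {a} ∩ Φ ⁻¹' B = p ⁻¹' {a} ∩ θ (β a) ⁻¹' B := by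
        ext i
        refine and_congr_right fun hi => ?_
        have hi' : p i = a := hi
        rw [mem_preimage, mem_preimage, hpos i (hi' ▸ ha), hi']
      rw [heq]
      exact (hp a).inter ((hθ _ (hβ' _ ha)).1 hB)
    · have hc : {i | p i ∈ Dᶜ}.Countable := countable_coe_iff.1 hIc
      refine (hc.mono ?_).measurableSet
      rintro i ⟨hi, -⟩
      have hi' : p i = a := hi
      change p i ∉ D
      rwa [hi']
  · by_cases hi : p i ∈ D
    · have hj : p j ∈ D := by rwa [← hiff, ← hij, hiff]
      have hββ : β (p i) = β (p j) := by rw [← hqΦ i hi, ← hqΦ j hj, hij]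
      rw [hpos i hi, hpos j hj, ← hββ] at hij
      exact (hθ _ (hβ' _ hi)).2.1 hij
    · have hj : p j ∉ D := by rwa [← hiff, ← hij, hiff]
      rw [hneg i hi, hneg j hj] at hij
      exact congrArg Subtype.val (hφ hij)
  · by_cases hi : p i ∈ D
    · rw [hqΦ i hi]
      exact hβ _ hi
    · rw [hneg i hi]
      exact hφ' ⟨i, hi⟩

end MeasurableMatching

/-! ### Comparing global shapes with embeddings. -/

section GlobalShape
open Set MeasureTheory


theorem countableCoarseShape_le_of_embedding {A B : Type*} {r : Setoid A} {r' : Setoid B}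
    {g : A → B} (hg : g.Injective) (h : ∀ x y, r x y ↔ r' (g x) (g y)) :
    countableCoarseShape r ≤ countableCoarseShape r' := by
  intro m
  let φ : Set A → Set B := fun c => {b | ∃ a ∈ c, r' b (g a)}
  have hφ : ∀ y, φ {x | r x y} = {b | r' b (g y)} := by
    intro y
    ext b
    exact ⟨fun ⟨a, ha, hb⟩ => r'.trans hb ((h _ _).1 ha), fun hb => ⟨y, r.refl y, hb⟩⟩
  refine encard_le_encard_of_injOn (f := φ) ?_ ?_
  · rintro _ ⟨⟨y, rfl⟩, hm⟩
    rw [hφ]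
    refine ⟨⟨g y, rfl⟩, hm.trans ?_⟩
    exact encard_le_encard_of_injOn (f := g) (fun x hx => (h _ _).1 hx) hg.injOn
  · rintro _ ⟨⟨y, rfl⟩, -⟩ _ ⟨⟨y', rfl⟩, -⟩ heq
    rw [hφ, hφ] at heq
    have hyy : r y y' := (h _ _).2 (heq ▸ r'.refl (g y) : g y ∈ {b | r' b (g y')})
    ext x
    exact ⟨fun hx => r.trans hx hyy, fun hx => r.trans hx (r.symm hyy)⟩

theorem SimBorelEmbeds.globalCoarseShape_le {X : Type u} {Y : Type v} [MeasurableSpace X]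
    [MeasurableSpace Y] {E F : Setoid X} {E' F' : Setoid Y} (hFc' : HasCountableClasses F')
    (h : SimBorelEmbeds E F E' F') (W : UpperSet LocalCoarseShapes) :
    Cardinal.lift.{v, u} (globalCoarseShape E F W) ≤
      Cardinal.lift.{u, v} (globalCoarseShape E' F' W) := by
  obtain ⟨f, -, hf, hE, hF⟩ := h
  -- The saturation of the image: `f` need not map a class onto a class.
  let φ : Set X → Set Y := fun C => {y | ∃ x ∈ C, F' y (f x)}
  have hφ : ∀ a, φ {x | F x a} = {y | F' y (f a)} := by
    intro a
    ext y
    exact ⟨fun ⟨x, hx, hy⟩ => F'.trans hy ((hF _ _).1 hx), fun hy => ⟨a, F.refl a, hy⟩⟩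
  have hmem : ∀ C ∈ F.classes, φ C ∈ F'.classes := by
    rintro _ ⟨a, rfl⟩
    exact ⟨f a, hφ a⟩
  have hle : ∀ C, localCoarseShape E C ≤ localCoarseShape E' (φ C) := fun C =>
    countableCoarseShape_le_of_embedding
      (g := fun x : C => (⟨f x, x, x.2, F'.refl _⟩ : φ C))
      (fun x y hxy => Subtype.ext (hf (congrArg Subtype.val hxy))) fun x y => hE x y
  refine Cardinal.lift_mk_le'.2 ⟨⟨fun C => ⟨φ C.1, hmem _ C.2.1, ?_⟩, ?_⟩⟩
  · obtain ⟨α, hα, hαC⟩ := C.2.2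
    refine ⟨⟨_, localCoarseShape_mem E' F' hFc' _ (hmem _ C.2.1)⟩, W.upper ?_ hα, rfl⟩
    change α.1 ≤ _
    rw [hαC]
    exact hle _
  · rintro ⟨_, ⟨a, rfl⟩, _⟩ ⟨_, ⟨b, rfl⟩, _⟩ hab
    have hab' : φ {x | F x a} = φ {x | F x b} := congrArg Subtype.val hab
    rw [hφ, hφ] at hab'
    have h' : F a b := (hF _ _).2 (hab' ▸ F'.refl (f a) : f a ∈ {y | F' y (f b)})
    refine Subtype.ext ?_
    ext x
    exact ⟨fun hx => F.trans hx h', fun hx => F.trans hx (F.symm h')⟩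

namespace BorelCoordinates

variable {X Z : Type*} [MeasurableSpace X] [MeasurableSpace Z] {E F : Setoid X}

theorem fibre_mem_classes (c : BorelCoordinates E F Z) (z : range c.base) :
    {x | c.base x = z} ∈ F.classes := by
  obtain ⟨_, a, rfl⟩ := z
  refine ⟨a, ?_⟩
  ext x
  exact (c.large_iff x a).symm

/-- The local coarse shape of the `F`-class over a point of the range of `base`. -/
noncomputable def shape (c : BorelCoordinates E F Z) (hF : HasCountableClasses F)
    (z : range c.base) : LocalCoarseShapes :=
  ⟨localCoarseShape E {x | c.base x = z}, localCoarseShape_mem E F hF _ (c.fibre_mem_classes z)⟩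

theorem measurableSet_shape_eq [StandardBorelSpace X] [StandardBorelSpace Z]
    (c : BorelCoordinates E F Z) (hF : HasCountableClasses F) (a : LocalCoarseShapes) :
    MeasurableSet (c.shape hF ⁻¹' {a}) := by
  have : c.shape hF ⁻¹' {a} = ⋂ m : ShapeIndex,
      (fun z : range c.base => {i | m.1 ≤ c.size z i}.encard) ⁻¹' {a.1 m} := by
    ext z
    simp only [mem_preimage, mem_singleton_iff, mem_iInter, Subtype.ext_iff, shape, funext_iff,
      c.localCoarseShape_eq]
  rw [this]
  refine .iInter fun m => (Measurable.encard_of_pred fun i => ?_) .of_discrete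
  exact ((c.measurable_size i).comp measurable_subtype_coe) (.of_discrete (s := Ici m.1))

/-- The points over which the shape lies in `W` correspond to the `F`-classes with shape in `W`. -/
noncomputable def shapeEquiv (c : BorelCoordinates E F Z) (hF : HasCountableClasses F)
    (W : UpperSet LocalCoarseShapes) :
    {z // c.shape hF z ∈ W} ≃
      {C : Set X // C ∈ F.classes ∧ ∃ α ∈ W, α.1 = localCoarseShape E C} :=
  Equiv.ofBijective
    (fun z => ⟨{x | c.base x = z.1}, c.fibre_mem_classes z.1, c.shape hF z.1, z.2, rfl⟩) <| by
    constructor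
    · rintro ⟨⟨_, x, rfl⟩, _⟩ ⟨⟨z, hz⟩, _⟩ h
      have h' : {y | c.base y = c.base x} = {y | c.base y = z} := congrArg Subtype.val h
      have : x ∈ {y | c.base y = z} := h' ▸ (rfl : c.base x = c.base x)
      exact Subtype.ext (Subtype.ext this)
    · rintro ⟨_, ⟨a, rfl⟩, α, hα, hαC⟩
      have hset : {x | c.base x = c.base a} = {x | F x a} := by
        ext x
        exact (c.large_iff x a).symm
      refine ⟨⟨⟨c.base a, a, rfl⟩, ?_⟩, Subtype.ext hset⟩
      have : c.shape hF ⟨c.base a, a, rfl⟩ = α := by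
        refine Subtype.ext ?_
        rw [hαC, shape]
        dsimp only
        rw [hset]
      rwa [this]

end BorelCoordinates

/-- In coordinates the embedding is `(z, i, k) ↦ (Φ z, φ z i, k)`. Ranks fill initial segments and
the target row is at least as long, so a point with these coordinates exists. -/
theorem simBorelEmbeds_of_globalCoarseShape_le {X : Type u} {Y : Type v} [MeasurableSpace X]
    [StandardBorelSpace X] [MeasurableSpace Y] [StandardBorelSpace Y]
    {E F : Setoid X} {E' F' : Setoid Y}
    (hEF : ∀ x y, E x y → F x y) (hEF' : ∀ x y, E' x y → F' x y)
    (hE : IsSmoothRel E) (hF : IsSmoothRel F) (hFc : HasCountableClasses F)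
    (hE' : IsSmoothRel E') (hF' : IsSmoothRel F') (hFc' : HasCountableClasses F')
    (h : ∀ W : UpperSet LocalCoarseShapes, Cardinal.lift.{v, u} (globalCoarseShape E F W) ≤
      Cardinal.lift.{u, v} (globalCoarseShape E' F' W)) :
    SimBorelEmbeds E F E' F' := by
  obtain ⟨Z, _, _, ⟨c⟩⟩ := exists_borelCoordinates E F hEF hE hF hFc
  obtain ⟨Z', _, _, ⟨c'⟩⟩ := exists_borelCoordinates E' F' hEF' hE' hF' hFc'
  have := c.measurableSet_range_base.standardBorel
  have := c'.measurableSet_range_base.standardBorel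
  obtain ⟨Φ, hΦm, hΦ, hΦle⟩ := exists_measurable_injective_le (c.measurableSet_shape_eq hFc)
    (c'.measurableSet_shape_eq hFc') fun W hW => by
      obtain ⟨e⟩ := Cardinal.lift_mk_le'.1 (h ⟨W, hW⟩)
      exact ⟨(c.shapeEquiv hFc ⟨W, hW⟩).toEmbedding.trans
        (e.trans (c'.shapeEquiv hFc' ⟨W, hW⟩).symm.toEmbedding)⟩
  obtain ⟨φ, hφm, hφle, hφinj⟩ := exists_measurable_matching
    (s := fun (z : range c.base) i => c.size z i) (t := fun z j => c'.size (Φ z) j)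
    (fun i => (c.measurable_size i).comp measurable_subtype_coe)
    (fun j => (c'.measurable_size j).comp (measurable_subtype_coe.comp hΦm))
    fun z m hm => by
      have : localCoarseShape E {x | c.base x = z} ⟨m, hm⟩ ≤
        localCoarseShape E' {y | c'.base y = Φ z} ⟨m, hm⟩ := hΦle z ⟨m, hm⟩
      rwa [c.localCoarseShape_eq, c'.localCoarseShape_eq] at this
  let ζ : X → range c.base := fun x => ⟨c.base x, x, rfl⟩
  have hζm : Measurable ζ := c.measurable_base.subtype_mk
  have hζ : ∀ x y, ζ x = ζ y ↔ c.base x = c.base y := fun x y => Subtype.ext_iff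
  have hone : ∀ x, 1 ≤ c.size (ζ x) (c.row x) := fun x =>
    Order.one_le_iff_ne_zero.2 (ne_bot_of_gt (c.rank_lt_size x))
  choose f hf0 hf1 hf2 using fun x => c'.exists_of_lt_size
    ((c.rank_lt_size x).trans_le (hφle (ζ x) (c.row x) (hone x)))
  have hbase : ∀ x y, c'.base (f x) = c'.base (f y) ↔ c.base x = c.base y := fun x y => by
    rw [hf0, hf0, Subtype.val_inj, hΦ.eq_iff, hζ]
  have hrow : ∀ x y, c.base x = c.base y →
      (c'.row (f x) = c'.row (f y) ↔ c.row x = c.row y) := fun x y hxy => by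
    have hz := (hζ x y).2 hxy
    rw [hf1, hf1, hz]
    exact ⟨hφinj _ _ _ (hz ▸ hone x) (hone y), fun h => by rw [h]⟩
  refine ⟨f, ?_, fun x y hxy => ?_, fun x y => ?_, fun x y => ?_⟩
  · rw [← c'.measurableEmbedding.measurable_comp_iff]
    have : (fun y => (c'.base y, c'.row y, c'.rank y)) ∘ f =
        fun x => ((Φ (ζ x) : Z'), φ (ζ x) (c.row x), c.rank x) := by
      funext x
      simp only [Function.comp_apply, hf0, hf1, hf2]
    rw [this]
    refine (measurable_subtype_coe.comp (hΦm.comp hζm)).prodMk (Measurable.prodMk ?_ c.measurable_rank)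
    exact (measurable_from_prod_countable_left
      (f := fun p : range c.base × ℕ => φ p.1 p.2) hφm).comp (hζm.prodMk c.measurable_row)
  · have h0 := (hbase x y).1 (by rw [hxy])
    refine c.eq_of_eq x y h0 ((hrow x y h0).1 (by rw [hxy])) ?_
    rw [← hf2 x, ← hf2 y, hxy]
  · rw [c.small_iff, c'.small_iff, hbase]
    exact and_congr_right fun h0 => (hrow x y h0).symm
  · rw [c.large_iff, c'.large_iff, hbase]

end GlobalShape

theorem theorem5p4 {X : Type u} {Y : Type v}
    [MeasurableSpace X] [StandardBorelSpace X] [MeasurableSpace Y] [StandardBorelSpace Y]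
    (E F : Setoid X) (E' F' : Setoid Y)
    (hEF : ∀ x y, E x y → F x y) (hEF' : ∀ x y, E' x y → F' x y)
    (hE : IsSmoothRel E) (hEc : HasCountableClasses E)
    (hF : IsSmoothRel F) (hFc : HasCountableClasses F)
    (hE' : IsSmoothRel E') (hEc' : HasCountableClasses E')
    (hF' : IsSmoothRel F') (hFc' : HasCountableClasses F') :
    (SimBorelEmbeds E F E' F' ↔
      ∀ W : UpperSet LocalCoarseShapes,
        Cardinal.lift.{v, u} (globalCoarseShape E F W) ≤
          Cardinal.lift.{u, v} (globalCoarseShape E' F' W)) ∧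
    ((SimBorelEmbeds E F E' F' ∧ SimBorelEmbeds E' F' E F) ↔
      ∀ W : UpperSet LocalCoarseShapes,
        Cardinal.lift.{v, u} (globalCoarseShape E F W) =
          Cardinal.lift.{u, v} (globalCoarseShape E' F' W)) := by
  have h1 : SimBorelEmbeds E F E' F' ↔ ∀ W : UpperSet LocalCoarseShapes,
      Cardinal.lift.{v, u} (globalCoarseShape E F W) ≤
        Cardinal.lift.{u, v} (globalCoarseShape E' F' W) :=
    ⟨fun h => h.globalCoarseShape_le hFc',
      simBorelEmbeds_of_globalCoarseShape_le hEF hEF' hE hF hFc hE' hF' hFc'⟩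
  have h2 : SimBorelEmbeds E' F' E F ↔ ∀ W : UpperSet LocalCoarseShapes,
      Cardinal.lift.{u, v} (globalCoarseShape E' F' W) ≤
        Cardinal.lift.{v, u} (globalCoarseShape E F W) :=
    ⟨fun h => h.globalCoarseShape_le hFc,
      simBorelEmbeds_of_globalCoarseShape_le hEF' hEF hE' hF' hFc' hE hF hFc⟩
  refine ⟨h1, ?_⟩
  rw [h1, h2, ← forall_and]
  exact forall_congr' fun W => le_antisymm_iff.symm
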